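/- Let $\kappa$ be an infinite cardinal with $\kappa=\kappa^{<\kappa}$. In a zero-dimensional space (one with a basis of clopen sets) the type of an open set $U$ is the least cardinal $\tau$ such that $U$ is a union of $\tau$ many clopen sets. An $F_\kappa$-space is a zero-dimensional space in which every open set $U$ of type less than $\kappa$ is $C^*$-embedded (every bounded continuous function $U\to\mathbb{R}$ extends to a bounded continuous function on the whole space). A $\kappa$-Parovičenko space is a compact Hausdorff zero-dimensional $F_\kappa$-space of weight $\kappa^{<\kappa}$, without isolated points, in which every non-empty intersection of fewer than $\kappa$ many open sets has non-empty interior. A $P_\kappa$-point of a space is a point $p$ such that every intersection of fewer than $\kappa$ many neighbourhoods of $p$ contains an open neighbourhood of $p$. A finite compactification of a space $Y$ is a compact Hausdorff space $Z$ containing $Y$ as a dense subspace such that the remainder $Z\setminus Y$ is finite. **Theorem.** Let $S_\kappa$ be a $\kappa$-Parovičenko space of weight $\kappa=\kappa^{<\kappa}$ (it is well known that such a space is unique up to homeomorphism), let $x\in S_\kappa$, and let $Z$ be a finite compactification of $S_\kappa\setminus\{x\}$. Then $Z$ is homeomorphic to $S_\kappa$, and at most one point of the remainder $Z\setminus(S_\kappa\setminus\{x\})$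 is not a $P_\kappa$-point of $Z$. -/

import Mathlib

open Set Topology Cardinal
open scoped BoundedContinuousFunction

universe u v

namespace KappaParovicenko

/-- The weight of a topological space: the least cardinality of a basis. -/
noncomputable def weight (X : Type u) [TopologicalSpace X] : Cardinal.{u} :=
  sInf {c | ∃ B : Set (Set X), TopologicalSpace.IsTopologicalBasis B ∧ #B = c}

/-- A space is zero-dimensional if its clopen subsets form a basis. -/
def IsZeroDimensional (X : Type u) [TopologicalSpace X] : Prop :=
  TopologicalSpace.IsTopologicalBasis {s : Set X | IsClopen s}

/-- The type of an open subset `U` of a zero-dimensional space: the least cardinal `τ` such that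
`U` is a union of `τ` many clopen sets. (In a zero-dimensional space every open set is a union of
clopen sets, so the infimum is attained.) -/
noncomputable def openType {X : Type u} [TopologicalSpace X] (U : Set X) : Cardinal.{u} :=
  sInf {c | ∃ C : Set (Set X), (∀ s ∈ C, IsClopen s) ∧ ⋃₀ C = U ∧ #C = c}

/-- `A` is `C*`-embedded in `X`: every bounded continuous real-valued function on the subspace `A`
extends to a bounded continuous function on `X`. -/
def IsCStarEmbedded {X : Type u} [TopologicalSpace X] (A : Set X) : Prop :=
  ∀ f : A →ᵇ ℝ, ∃ g : X →ᵇ ℝ, ∀ a : A, g a = f a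

/-- An `F_κ`-space: a zero-dimensional space in which open subsets of type less than `κ` are
`C*`-embedded. -/
structure IsFSpace (κ : Cardinal.{u}) (X : Type u) [TopologicalSpace X] : Prop where
  zeroDim : IsZeroDimensional X
  cstar : ∀ U : Set X, IsOpen U → openType U < κ → IsCStarEmbedded U

/-- A `κ`-Parovičenko space: a zero-dimensional compact Hausdorff `F_κ`-space of weight `κ^{<κ}`
without isolated points in which every nonempty intersection of fewer than `κ` many open sets has
nonempty interior. -/
structure IsParovicenko (κ : Cardinal.{u}) (X : Type u) [TopologicalSpace X] : Prop where
  compact : CompactSpace X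
  hausdorff : T2Space X
  fSpace : IsFSpace κ X
  weight_eq : weight X = κ ^< κ
  no_isolated : ∀ x : X, ¬ IsOpen ({x} : Set X)
  interior_nonempty : ∀ (ι : Type u) (U : ι → Set X), #ι < κ → (∀ i, IsOpen (U i)) →
    (⋂ i, U i).Nonempty → (interior (⋂ i, U i)).Nonempty

/-- A `P_κ`-point: every intersection of fewer than `κ` many neighbourhoods of `p` contains an open
neighbourhood of `p`. -/
def IsPPoint (κ : Cardinal.{u}) {Z : Type v} [TopologicalSpace Z] (p : Z) : Prop :=
  ∀ (ι : Type u) (U : ι → Set Z), #ι < κ → (∀ i, U i ∈ 𝓝 p) →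
    ∃ V : Set Z, IsOpen V ∧ p ∈ V ∧ V ⊆ ⋂ i, U i

/-- `e : Y → Z` is a finite compactification of `Y`: `Z` is compact Hausdorff, `e` is a homeomorphic
embedding onto a dense subspace, and the remainder `Z \ e(Y)` is finite. -/
structure IsFiniteCompactification {Y : Type u} {Z : Type v} [TopologicalSpace Y]
    [TopologicalSpace Z] (e : Y → Z) : Prop where
  compact : CompactSpace Z
  hausdorff : T2Space Z
  embedding : IsEmbedding e
  dense : DenseRange e
  finite_remainder : (range e)ᶜ.Finite

end KappaParovicenko

/-!
Let `F` be the remainder and `r : Z → S` the map that is the identity on `S \ {x}` and sends `F` to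
`x`. It is continuous since `S` is the one-point compactification of `S \ {x}` (`IsCollapse`), and
clopen subsets of `Z` that miss `F` are carried to clopen subsets of `S`.

The `F_κ`-property of `S` is used in the form: disjoint unions of fewer than `κ` clopen sets have
disjoint closures. A point of `F` that is not a `P_κ`-point is in the closure of a union of fewer
than `κ` clopen sets missing `F`, inside any given clopen neighbourhood. Two such points would
yield two disjoint unions of this kind in `S` that both have `x` in their closure
(`IsCollapse.subsingleton_not_isPPoint`).

For the homeomorphism, `Z` is shown to have the same characteristic properties as `S`
(`IsCollapse.isSaturatedSpace`). The delicate one is that nonempty intersections of fewer than `κ`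
open sets have nonempty interior, at a point of `F`. By the property in `S` it suffices that the
intersection is not contained in `F` (`IsCollapse.exists_mem_iInter_ne`). This rests on a splitting
lemma (`IsSaturatedSpace.exists_splitting`): given fewer than `κ` nonempty open sets, there are two
disjoint unions of fewer than `κ` clopen sets both meeting all of them. Splitting the traces of the
finite subintersections on `S \ {x}` would again produce two such unions with `x` in both closures.

Uniqueness of the space with these properties is proved through its clopen algebra. Splitting also
shows that this algebra is `κ`-saturated (`IsSaturatedSpace.isSaturated_clopens`). Two `κ`-saturated
Boolean algebras of size at most `κ` are isomorphic by a back-and-forth construction of length `κ`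
(`IsSaturated.nonempty_orderIso`), and an isomorphism of clopen algebras comes from a homeomorphism
(`nonempty_homeomorph_of_clopens_orderIso`).
-/

namespace KappaParovicenko

/-! ### Back-and-forth between saturated Boolean algebras -/

section BackAndForth

variable {ι A B : Type*} [BooleanAlgebra A] [BooleanAlgebra B]

/-- The element `⋀_{i ∈ F} f i ∧ ⋀_{i ∈ G} ¬ f i` for a pair `p = (F, G)` of finite index sets.
Over all pairs of finite subsets of an index set `R` these generate, under finite joins, the
subalgebra generated by the `f i` with `i ∈ R`. -/
def cell (f : ι → A) (p : Finset ι × Finset ι) : A := p.1.inf f ⊓ (p.2.sup f)ᶜ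

/-- The families `a` and `b`, restricted to the index set `R`, satisfy the same inequalities between
finite meets and finite joins. Equivalently, `a i ↦ b i` for `i ∈ R` extends to an isomorphism
between the generated Boolean subalgebras. -/
def Matching (R : Set ι) (a : ι → A) (b : ι → B) : Prop :=
  ∀ F G : Finset ι, ↑F ⊆ R → ↑G ⊆ R → (F.inf a ≤ G.sup a ↔ F.inf b ≤ G.sup b)

/-- The elements `α` and `β` are in the same position with respect to the subalgebras generated by
the `a i` and by the `b i` for `i ∈ R`. -/
def Fits (R : Set ι) (a : ι → A) (b : ι → B) (α : A) (β : B) : Prop :=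
  ∀ p : Finset ι × Finset ι, ↑p.1 ⊆ R → ↑p.2 ⊆ R →
    (cell a p ≤ αᶜ ↔ cell b p ≤ βᶜ) ∧ (cell a p ≤ α ↔ cell b p ≤ β)

lemma Matching.symm {R : Set ι} {a : ι → A} {b : ι → B} (h : Matching R a b) : Matching R b a :=
  fun F G hF hG => (h F G hF hG).symm

lemma Fits.symm {R : Set ι} {a : ι → A} {b : ι → B} {α : A} {β : B} (h : Fits R a b α β) :
    Fits R b a β α :=
  fun p h1 h2 => ⟨(h p h1 h2).1.symm, (h p h1 h2).2.symm⟩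

lemma inf_compl_le_iff_le_sup (x y r : A) : x ⊓ yᶜ ≤ r ↔ x ≤ y ⊔ r := by
  rw [← _root_.sdiff_eq, sdiff_le_iff]

lemma cell_le_iff (f : ι → A) (p : Finset ι × Finset ι) (r : A) :
    cell f p ≤ r ↔ p.1.inf f ≤ p.2.sup f ⊔ r := by
  rw [cell, inf_compl_le_iff_le_sup]

variable [DecidableEq ι]

lemma cell_union (f : ι → A) (p q : Finset ι × Finset ι) :
    cell f (p.1 ∪ q.1, p.2 ∪ q.2) = cell f p ⊓ cell f q := by
  simp only [cell, Finset.inf_union, Finset.sup_union, compl_sup]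
  exact inf_inf_inf_comm _ _ _ _

lemma cell_le_cell_sup_iff (f : ι → A) (p q : Finset ι × Finset ι) (r : A) :
    cell f p ≤ cell f q ⊔ r ↔
      (∀ i ∈ q.1, cell f (p.1, insert i p.2) ≤ r) ∧ ∀ i ∈ q.2, cell f (insert i p.1, p.2) ≤ r := by
  have h1 : ∀ i, cell f (p.1, insert i p.2) = cell f p ⊓ (f i)ᶜ := fun i => by
    simp only [cell, Finset.sup_insert, compl_sup]; ac_rfl
  have h2 : ∀ i, cell f (insert i p.1, p.2) = cell f p ⊓ f i := fun i => by
    simp only [cell, Finset.inf_insert]; ac_rfl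
  simp only [h1, h2]
  generalize cell f p = x
  have h3 : ∀ y : A, x ≤ y ⊔ r ↔ x ⊓ rᶜ ≤ y := fun y => by
    rw [inf_compl_le_iff_le_sup, sup_comm]
  rw [h3, cell, le_inf_iff, Finset.le_inf_iff, le_compl_comm, Finset.sup_le_iff]
  refine and_congr (forall₂_congr fun i _ => ?_) (forall₂_congr fun i _ => ?_)
  · rw [← h3, inf_compl_le_iff_le_sup]
  · rw [compl_inf, compl_compl, ← inf_compl_le_iff_le_sup, compl_compl, inf_comm]

/-- A matching respects inequalities between cells and finite joins of cells. -/
lemma Matching.cell_le_sup_iff {R : Set ι} {a : ι → A} {b : ι → B} (h : Matching R a b)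
    (J : Finset (Finset ι × Finset ι)) (hJ : ∀ q ∈ J, ↑q.1 ⊆ R ∧ ↑q.2 ⊆ R)
    (p : Finset ι × Finset ι) (hp1 : ↑p.1 ⊆ R) (hp2 : ↑p.2 ⊆ R) :
    cell a p ≤ J.sup (cell a) ↔ cell b p ≤ J.sup (cell b) := by
  classical
  induction J using Finset.induction_on generalizing p with
  | empty => simpa only [cell_le_iff, Finset.sup_empty, sup_bot_eq] using h p.1 p.2 hp1 hp2
  | insert q J hq ih =>
    have hJ' : ∀ q ∈ J, ↑q.1 ⊆ R ∧ ↑q.2 ⊆ R := fun q hq => hJ q (Finset.mem_insert_of_mem hq)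
    obtain ⟨hq1, hq2⟩ := hJ q (Finset.mem_insert_self _ _)
    rw [Finset.sup_insert, Finset.sup_insert, cell_le_cell_sup_iff, cell_le_cell_sup_iff]
    refine and_congr (forall₂_congr fun i hi => ih hJ' _ hp1 ?_)
      (forall₂_congr fun i hi => ih hJ' _ ?_ hp2)
    · simpa [Set.insert_subset_iff] using ⟨hq1 hi, hp2⟩
    · simpa [Set.insert_subset_iff] using ⟨hq2 hi, hp1⟩

lemma Matching.insert {R : Set ι} {a : ι → A} {b : ι → B} (h : Matching R a b) (j : ι)
    (hj : Fits R a b (a j) (b j)) : Matching (insert j R) a b := by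
  intro F G hF hG
  have key : ∀ F : Finset ι, ↑F ⊆ Insert.insert j R → ↑(F.erase j) ⊆ R := fun F hF i hi => by
    have := hF (Finset.mem_of_mem_erase hi)
    exact this.resolve_left (Finset.ne_of_mem_erase hi)
  by_cases hjF : j ∈ F <;> by_cases hjG : j ∈ G
  · exact iff_of_true ((Finset.inf_le hjF).trans (Finset.le_sup hjG))
      ((Finset.inf_le hjF).trans (Finset.le_sup hjG))
  · have := (hj (F.erase j, G) (key F hF) (by simpa [hjG] using key G hG)).1
    rw [← Finset.insert_erase hjF, Finset.inf_insert, Finset.inf_insert]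
    simp only [cell_le_iff] at this
    rw [inf_comm, inf_comm (b j), ← compl_compl (a j), ← compl_compl (b j),
      inf_compl_le_iff_le_sup, inf_compl_le_iff_le_sup, sup_comm, sup_comm _ (G.sup b)]
    exact this
  · have := (hj (F, G.erase j) (by simpa [hjF] using key F hF) (key G hG)).2
    simp only [cell_le_iff] at this
    rw [← Finset.insert_erase hjG, Finset.sup_insert, Finset.sup_insert, sup_comm,
      sup_comm (b j)]
    exact this
  · exact h F G (by simpa [hjF] using key F hF) (by simpa [hjG] using key G hG)

end BackAndForth

/-- A `κ`-saturated Boolean algebra: fewer than `κ` many conditions of the forms `l ≤ b`,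
`b ⊓ m = ⊥`, `b ⊓ g ≠ ⊥`, `¬ h ≤ b` on an element `b` can be met simultaneously as soon as the
obvious necessary finitary conditions hold. -/
def IsSaturated (κ : Cardinal.{u}) (A : Type u) [BooleanAlgebra A] : Prop :=
  ∀ L M G H : Set A, #L < κ → #M < κ → #G < κ → #H < κ →
    (∀ l ∈ L, ∀ m ∈ M, Disjoint l m) →
    (∀ g ∈ G, ∀ t : Finset A, ↑t ⊆ M → ¬ g ≤ t.sup id) →
    (∀ h ∈ H, ∀ t : Finset A, ↑t ⊆ L → ¬ h ≤ t.sup id) →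
    ∃ b : A, (∀ l ∈ L, l ≤ b) ∧ (∀ m ∈ M, m ≤ bᶜ) ∧ (∀ g ∈ G, ¬ g ≤ bᶜ) ∧ ∀ h ∈ H, ¬ h ≤ b

lemma mk_finset_lt {κ : Cardinal.{u}} (hκ : ℵ₀ ≤ κ) {α : Type u} (h : #α < κ) :
    #(Finset α) < κ := by
  cases finite_or_infinite α
  · exact (lt_aleph0_of_finite _).trans_le hκ
  · rwa [mk_finset_of_infinite]

lemma mk_cell_index_lt {κ : Cardinal.{u}} (hκ : ℵ₀ ≤ κ) {ι : Type u} {R : Set ι} (h : #R < κ) :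
    #{p : Finset ι × Finset ι | ↑p.1 ⊆ R ∧ ↑p.2 ⊆ R} < κ := by
  classical
  have h1 : {p : Finset ι × Finset ι | ↑p.1 ⊆ R ∧ ↑p.2 ⊆ R} ⊆
      range fun q : Finset R × Finset R => (q.1.image (↑), q.2.image (↑)) := by
    rintro ⟨F, G⟩ ⟨hF, hG⟩
    refine ⟨(F.subtype (· ∈ R), G.subtype (· ∈ R)), ?_⟩
    ext i
    · simpa using @hF i
    · simpa using @hG i
  refine (mk_le_mk_of_subset h1).trans_lt (mk_range_le.trans_lt ?_)
  rw [mk_prod, Cardinal.lift_id]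
  exact mul_lt_of_lt hκ (mk_finset_lt hκ h) (mk_finset_lt hκ h)

/-- One step of the back-and-forth: saturation provides a partner for any element. -/
lemma IsSaturated.exists_fits {κ : Cardinal.{u}} (hκ : ℵ₀ ≤ κ) {ι A B : Type u} [BooleanAlgebra A]
    [BooleanAlgebra B] (hB : IsSaturated κ B) {R : Set ι} (hR : #R < κ) {a : ι → A} {b : ι → B}
    (h : Matching R a b) (α : A) : ∃ β, Fits R a b α β := by
  classical
  set P : Set (Finset ι × Finset ι) := {p | ↑p.1 ⊆ R ∧ ↑p.2 ⊆ R} with hP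
  have hPκ : #P < κ := mk_cell_index_lt hκ hR
  have hcard : ∀ Q : Finset ι × Finset ι → Prop, #(cell b '' {p ∈ P | Q p}) < κ := fun Q =>
    mk_image_le.trans_lt ((mk_le_mk_of_subset (sep_subset _ _)).trans_lt hPκ)
  -- a cell that is covered by finitely many cells on one side is so covered on the other side
  have hfin : ∀ (γ : A) (p : Finset ι × Finset ι), p ∈ P → ¬ cell a p ≤ γ → ∀ t : Finset B,
      ↑t ⊆ cell b '' {q ∈ P | cell a q ≤ γ} → ¬ cell b p ≤ t.sup id := by
    intro γ p hp hpγ t ht hle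
    obtain ⟨J, hJ, rfl⟩ := Finset.subset_set_image_iff.1 ht
    rw [Finset.sup_image, Function.id_comp,
      ← h.cell_le_sup_iff J (fun q hq => (hJ hq).1) p hp.1 hp.2] at hle
    exact hpγ (hle.trans (Finset.sup_le fun q hq => (hJ hq).2))
  obtain ⟨β, h1, h2, h3, h4⟩ := hB (cell b '' {p ∈ P | cell a p ≤ α})
    (cell b '' {p ∈ P | cell a p ≤ αᶜ}) (cell b '' {p ∈ P | ¬ cell a p ≤ αᶜ})
    (cell b '' {p ∈ P | ¬ cell a p ≤ α}) (hcard _) (hcard _) (hcard _) (hcard _)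
    (by
      rintro _ ⟨p, ⟨hp, hpα⟩, rfl⟩ _ ⟨q, ⟨hq, hqα⟩, rfl⟩
      have h0 : cell a (p.1 ∪ q.1, p.2 ∪ q.2) ≤ (∅ : Finset (Finset ι × Finset ι)).sup (cell a) := by
        rw [cell_union, Finset.sup_empty, ← inf_compl_self α]
        exact inf_le_inf hpα hqα
      rw [h.cell_le_sup_iff ∅ (by simp) _ (by simpa using ⟨hp.1, hq.1⟩)
        (by simpa using ⟨hp.2, hq.2⟩), cell_union, Finset.sup_empty] at h0
      exact disjoint_iff_inf_le.2 h0)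
    (by
      rintro _ ⟨p, ⟨hp, hpα⟩, rfl⟩
      exact hfin _ p hp hpα)
    (by
      rintro _ ⟨p, ⟨hp, hpα⟩, rfl⟩
      exact hfin _ p hp hpα)
  refine ⟨β, fun p hp1 hp2 => ⟨⟨fun hp => h2 _ ⟨p, ⟨⟨hp1, hp2⟩, hp⟩, rfl⟩, fun hp => ?_⟩,
    ⟨fun hp => h1 _ ⟨p, ⟨⟨hp1, hp2⟩, hp⟩, rfl⟩, fun hp => ?_⟩⟩⟩
  · by_contra hn
    exact h3 _ ⟨p, ⟨⟨hp1, hp2⟩, hn⟩, rfl⟩ hp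
  · by_contra hn
    exact h4 _ ⟨p, ⟨⟨hp1, hp2⟩, hn⟩, rfl⟩ hp

/-- Saturated Boolean algebras of cardinality at most `κ` are isomorphic. -/
theorem IsSaturated.nonempty_orderIso {κ : Cardinal.{u}} (hκ : ℵ₀ ≤ κ) {A B : Type u}
    [BooleanAlgebra A] [BooleanAlgebra B] [Nontrivial A] [Nontrivial B] (hA : IsSaturated κ A)
    (hB : IsSaturated κ B) (hAκ : #A ≤ κ) (hBκ : #B ≤ κ) : Nonempty (A ≃o B) := by
  classical
  -- `task` lists all elements of both algebras in order type `κ`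
  let I := κ.ord.ToType
  have hI : #I = κ := mk_ord_toType κ
  obtain ⟨task, htask⟩ : ∃ task : I → A ⊕ B, Function.Surjective task := by
    have : #(A ⊕ B) ≤ #I := by
      rw [mk_sum, lift_id, lift_id, hI]
      exact add_le_of_le hκ hAκ hBκ
    obtain ⟨g⟩ := this
    exact ⟨_, Function.invFun_surjective g.injective⟩
  let good : I → Set (A × B) → A × B → Prop := fun i R p =>
    Sum.elim (fun α => p.1 = α) (fun β => p.2 = β) (task i) ∧ Fits R Prod.fst Prod.snd p.1 p.2
  let f : I → A × B := (wellFounded_lt (α := I)).fix fun i rec =>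
    Classical.epsilon (good i {q | ∃ (j : I) (h : j < i), q = rec j h})
  have hf : ∀ i, f i = Classical.epsilon (good i (f '' Iio i)) := fun i => by
    have h1 : f '' Iio i = {q | ∃ (j : I) (_ : j < i), q = f j} := by
      ext q
      simp [eq_comm]
    rw [h1]
    exact (wellFounded_lt (α := I)).fix_eq _ i
  have hgood : ∀ i, Matching (f '' Iio i) Prod.fst Prod.snd → good i (f '' Iio i) (f i) := by
    intro i hi
    rw [hf i]
    refine Classical.epsilon_spec (p := good i (f '' Iio i)) ?_
    have hcard : #(f '' Iio i) < κ := by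
      refine mk_image_le.trans_lt ?_
      simpa [hI] using mk_Iio_lt i (by simp [I])
    obtain ⟨α, hα⟩ | ⟨β, hβ⟩ : (∃ α, task i = .inl α) ∨ ∃ β, task i = .inr β := by
      cases task i <;> simp
    · obtain ⟨β, hβ⟩ := hB.exists_fits hκ hcard hi α
      exact ⟨(α, β), by simp [hα], hβ⟩
    · obtain ⟨α, hα⟩ := hA.exists_fits hκ hcard hi.symm β
      exact ⟨(α, β), by simp [hβ], hα.symm⟩
  -- matchings are of finite character, so it is enough to look at the last index involved
  have hfinite : ∀ S : Set I, (∀ j ∈ S, Matching (f '' Iic j) Prod.fst Prod.snd) →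
      Matching (f '' S) Prod.fst Prod.snd := by
    intro S hS F G hF hG
    obtain ⟨T, hTS, hT⟩ := Finset.subset_set_image_iff.1
      (show ↑(F ∪ G) ⊆ f '' S by simpa using ⟨hF, hG⟩)
    rcases T.eq_empty_or_nonempty with rfl | hne
    · obtain ⟨rfl, rfl⟩ : F = ∅ ∧ G = ∅ := Finset.union_eq_empty.1 (by simpa using hT.symm)
      simp
    · have hTle : ↑(F ∪ G) ⊆ f '' Iic (T.max' hne) := by
        rw [← hT, Finset.coe_image]
        exact image_mono fun j hj => T.le_max' j hj
      rw [Finset.coe_union, union_subset_iff] at hTle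
      exact hS _ (hTS (T.max'_mem hne)) F G hTle.1 hTle.2
  have hstep : ∀ i, Matching (f '' Iio i) Prod.fst Prod.snd →
      Matching (f '' Iic i) Prod.fst Prod.snd := fun i hi => by
    rw [← Iio_insert, image_insert_eq]
    exact hi.insert _ (hgood i hi).2
  have hall : ∀ i, Matching (f '' Iio i) Prod.fst Prod.snd := fun i => by
    induction i using WellFoundedLT.induction with
    | ind i ih => exact hfinite _ fun j hj => hstep j (ih j hj)
  have hrange : Matching (range f) Prod.fst Prod.snd := by
    rw [← image_univ]
    exact hfinite _ fun j _ => hstep j (hall j)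
  have hle : ∀ p ∈ range f, ∀ q ∈ range f, p.1 ≤ q.1 ↔ p.2 ≤ q.2 := fun p hp q hq => by
    simpa using hrange {p} {q} (by simpa using hp) (by simpa using hq)
  have hleft : ∀ α : A, ∃ β : B, (α, β) ∈ range f := fun α => by
    obtain ⟨i, hi⟩ := htask (.inl α)
    have := (hgood i (hall i)).1
    rw [hi, Sum.elim_inl] at this
    exact ⟨(f i).2, i, by rw [← this]⟩
  have hright : ∀ β : B, ∃ α : A, (α, β) ∈ range f := fun β => by
    obtain ⟨i, hi⟩ := htask (.inr β)
    have := (hgood i (hall i)).1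
    rw [hi, Sum.elim_inr] at this
    exact ⟨(f i).1, i, by rw [← this]⟩
  choose φ hφ using hleft
  refine ⟨RelIso.ofSurjective
    (OrderEmbedding.ofMapLEIff φ fun α α' => (hle _ (hφ α) _ (hφ α')).symm) fun β => ?_⟩
  obtain ⟨α, hα⟩ := hright β
  exact ⟨α, le_antisymm ((hle _ (hφ α) _ hα).1 le_rfl) ((hle _ hα _ (hφ α)).1 le_rfl)⟩

/-! ### Recovering a space from its clopen algebra -/

section Stone

variable {X Y : Type*} [TopologicalSpace X] [TopologicalSpace Y]

lemma exists_point_of_clopens_orderIso [CompactSpace Y]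
    (φ : TopologicalSpace.Clopens X ≃o TopologicalSpace.Clopens Y) (x : X) :
    ∃ y, ∀ c, x ∈ c ↔ y ∈ φ c := by
  have hne : (⋂ c : {c : TopologicalSpace.Clopens X // x ∈ c}, (φ c : Set Y)).Nonempty := by
    have : Nonempty {c : TopologicalSpace.Clopens X // x ∈ c} := ⟨⟨⊤, mem_univ x⟩⟩
    refine IsCompact.nonempty_iInter_of_directed_nonempty_isCompact_isClosed _ ?_ ?_
      (fun c => (φ c).isClosed.isCompact) fun c => (φ c).isClosed
    · intro c d
      refine ⟨⟨c ⊓ d, c.2, d.2⟩, ?_, ?_⟩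
      · exact φ.monotone (inf_le_left : c.1 ⊓ d.1 ≤ c.1)
      · exact φ.monotone (inf_le_right : c.1 ⊓ d.1 ≤ d.1)
    · intro c
      by_contra hc
      have h1 : φ c = ⊥ := SetLike.coe_injective (not_nonempty_iff_eq_empty.1 hc)
      rw [map_eq_bot_iff] at h1
      have h2 := c.2
      rw [h1] at h2
      exact h2
  obtain ⟨y, hy⟩ := hne
  rw [mem_iInter] at hy
  refine ⟨y, fun c => ⟨fun hc => hy ⟨c, hc⟩, fun hc => ?_⟩⟩
  by_contra hxc
  have h1 : y ∈ φ cᶜ := hy ⟨cᶜ, hxc⟩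
  have h2 : y ∈ φ c ⊓ φ cᶜ := ⟨hc, h1⟩
  rw [← map_inf, inf_compl_eq_bot, map_bot] at h2
  exact h2

lemma eq_of_forall_mem_clopens_iff [TotallySeparatedSpace X] {x y : X}
    (h : ∀ c : TopologicalSpace.Clopens X, x ∈ c ↔ y ∈ c) : x = y := by
  by_contra hxy
  obtain ⟨U, hU, hx, hy⟩ := exists_isClopen_of_totally_separated hxy
  exact hy ((h ⟨U, hU⟩).1 hx)

/-- The part of Stone duality saying that Stone spaces with isomorphic clopen algebras are
homeomorphic. -/
theorem nonempty_homeomorph_of_clopens_orderIso [CompactSpace X] [T2Space X]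
    [TotallyDisconnectedSpace X] [CompactSpace Y] [T2Space Y] [TotallyDisconnectedSpace Y]
    (φ : TopologicalSpace.Clopens X ≃o TopologicalSpace.Clopens Y) : Nonempty (X ≃ₜ Y) := by
  choose f hf using exists_point_of_clopens_orderIso φ
  choose g hg using exists_point_of_clopens_orderIso φ.symm
  have hfc : Continuous f := by
    refine isTopologicalBasis_isClopen.continuous_iff.2 fun d hd => ?_
    have : f ⁻¹' d = φ.symm ⟨d, hd⟩ := by
      ext x
      rw [SetLike.mem_coe, hf, OrderIso.apply_symm_apply]
      rfl
    rw [this]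
    exact (φ.symm ⟨d, hd⟩).isOpen
  let e : X ≃ Y :=
    { toFun := f
      invFun := g
      left_inv := fun x => eq_of_forall_mem_clopens_iff fun c => by
        rw [hf x c, hg (f x), OrderIso.symm_apply_apply]
      right_inv := fun y => eq_of_forall_mem_clopens_iff fun c => by
        rw [hg y c, hf (g y), OrderIso.apply_symm_apply] }
  exact ⟨Continuous.homeoOfEquivCompactToT2 (f := e) hfc⟩

end Stone

/-! ### Saturated spaces -/

/-- The Stone spaces of the atomless `κ`-saturated Boolean algebras of size at most `κ`. Compared
with `IsParovicenko`, the `F_κ`-property is expressed through disjoint closures of unions of fewer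
than `κ` clopen sets, and the weight through the number of clopen sets. -/
structure IsSaturatedSpace (κ : Cardinal.{u}) (X : Type u) [TopologicalSpace X] : Prop where
  compact : CompactSpace X
  hausdorff : T2Space X
  totallyDisconnected : TotallyDisconnectedSpace X
  mk_clopens_le : #(TopologicalSpace.Clopens X) ≤ κ
  no_isolated : ∀ x : X, ¬ IsOpen ({x} : Set X)
  interior_nonempty : ∀ (ι : Type u) (U : ι → Set X), #ι < κ → (∀ i, IsOpen (U i)) →
    (⋂ i, U i).Nonempty → (interior (⋂ i, U i)).Nonempty
  disjoint_closure : ∀ (ι ι' : Type u) (c : ι → Set X) (d : ι' → Set X), #ι < κ → #ι' < κ →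
    (∀ i, IsClopen (c i)) → (∀ j, IsClopen (d j)) → (∀ i j, Disjoint (c i) (d j)) →
    Disjoint (closure (⋃ i, c i)) (closure (⋃ j, d j))

namespace IsSaturatedSpace

variable {κ : Cardinal.{u}} {X : Type u} [TopologicalSpace X]

lemma exists_clopen_subset_diff (hX : IsSaturatedSpace κ X) (hκ : ℵ₀ ≤ κ) {O : Set X}
    (hO : IsOpen O) {ι : Type u} (hι : #ι < κ) {W : ι → Set X} (hW : ∀ i, IsClosed (W i))
    (hne : (O \ ⋃ i, W i).Nonempty) :
    ∃ c, IsClopen c ∧ c.Nonempty ∧ c ⊆ O \ ⋃ i, W i := by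
  have := hX.compact
  have := hX.hausdorff
  have := hX.totallyDisconnected
  have heq : ⋂ o : Option ι, o.elim O (fun i => (W i)ᶜ) = O \ ⋃ i, W i := by
    ext x
    simp [Option.forall]
  obtain ⟨x, hx⟩ := hX.interior_nonempty (Option ι) (fun o => o.elim O fun i => (W i)ᶜ)
    (by rw [mk_option]; exact add_lt_of_lt hκ hι (one_lt_aleph0.trans_le hκ))
    (by rintro (_ | i); exacts [hO, (hW i).isOpen_compl]) (by rwa [heq])
  rw [heq] at hx
  obtain ⟨c, hc, hxc, hcO⟩ := compact_exists_isClopen_in_isOpen isOpen_interior hx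
  exact ⟨c, hc, ⟨x, hxc⟩, hcO.trans interior_subset⟩

/-- If a nonempty open set had fewer than `κ` points, then removing all but one of them would leave
a set with nonempty interior, that is, an isolated point. -/
lemma le_mk_of_isOpen (hX : IsSaturatedSpace κ X) (hκ : ℵ₀ ≤ κ) {O : Set X} (hO : IsOpen O)
    (hne : O.Nonempty) : κ ≤ #O := by
  by_contra! hlt
  have := hX.hausdorff
  obtain ⟨p, hp⟩ := hne
  have heq : O \ ⋃ q : ↥(O \ {p}), {q.1} = {p} := by
    ext x
    simp only [iUnion_singleton_eq_range, Subtype.range_coe_subtype, mem_sdiff, mem_singleton_iff,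
      mem_ofPred_eq]
    refine ⟨fun h => by_contra fun hx => h.2 ⟨h.1, hx⟩, ?_⟩
    rintro rfl
    exact ⟨hp, fun h => h.2 rfl⟩
  obtain ⟨c, hc, hcne, hcp⟩ := hX.exists_clopen_subset_diff hκ hO
    ((mk_le_mk_of_subset sdiff_subset).trans_lt hlt) (W := fun q : ↥(O \ {p}) => {q.1})
    (fun _ => isClosed_singleton) (by rw [heq]; exact singleton_nonempty p)
  rw [heq, hcne.subset_singleton_iff] at hcp
  exact hX.no_isolated p (hcp ▸ hc.isOpen)

/-- Fewer than `κ` nonempty open sets can be split simultaneously. The `u i` avoid a set of chosen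
points `q j ∈ G j`, so that these points witness that the `G j` are not covered by the `u i`. -/
lemma exists_splitting (hX : IsSaturatedSpace κ X) (hκ : ℵ₀ ≤ κ) {ι : Type u} (hι : #ι < κ)
    {G : ι → Set X} (hG : ∀ i, IsOpen (G i)) (hne : ∀ i, (G i).Nonempty) :
    ∃ u v : ι → Set X, (∀ i, IsClopen (u i) ∧ (u i).Nonempty ∧ u i ⊆ G i) ∧
      (∀ i, IsClopen (v i) ∧ (v i).Nonempty ∧ v i ⊆ G i) ∧ ∀ i j, Disjoint (u i) (v j) := by
  have := hX.hausdorff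
  choose q hq using hne
  have h1 : ∀ i, (G i \ ⋃ j, {q j}).Nonempty := fun i => by
    by_contra hemp
    rw [not_nonempty_iff_eq_empty, sdiff_eq_empty, iUnion_singleton_eq_range] at hemp
    exact (hX.le_mk_of_isOpen hκ (hG i) ⟨q i, hq i⟩).not_gt
      ((mk_le_mk_of_subset hemp).trans_lt (mk_range_le.trans_lt hι))
  choose u hu hune huG using fun i =>
    hX.exists_clopen_subset_diff hκ (hG i) hι (fun j => isClosed_singleton) (h1 i)
  have h2 : ∀ i, (G i \ ⋃ j, u j).Nonempty := fun i => by
    refine ⟨q i, hq i, fun h => ?_⟩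
    obtain ⟨j, hj⟩ := mem_iUnion.1 h
    exact (huG j hj).2 (mem_iUnion.2 ⟨i, rfl⟩)
  choose v hv hvne hvG using fun i =>
    hX.exists_clopen_subset_diff hκ (hG i) hι (fun j => (hu j).isClosed) (h2 i)
  refine ⟨u, v, fun i => ⟨hu i, hune i, (huG i).trans sdiff_subset⟩,
    fun i => ⟨hv i, hvne i, (hvG i).trans sdiff_subset⟩, fun i j => ?_⟩
  exact disjoint_left.2 fun x hxu hxv => (hvG j hxv).2 (mem_iUnion.2 ⟨i, hxu⟩)

lemma diff_iUnion_nonempty [CompactSpace X] (g : TopologicalSpace.Clopens X)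
    (M : Set (TopologicalSpace.Clopens X))
    (h : ∀ t : Finset (TopologicalSpace.Clopens X), ↑t ⊆ M → ¬ g ≤ t.sup id) :
    ((g : Set X) \ ⋃ m : M, ((m : TopologicalSpace.Clopens X) : Set X)).Nonempty := by
  classical
  by_contra hemp
  rw [not_nonempty_iff_eq_empty, sdiff_eq_empty] at hemp
  obtain ⟨t, ht⟩ := g.isClosed.isCompact.elim_finite_subcover _ (fun m : M => m.1.isOpen) hemp
  refine h (t.image (↑)) (by simp) ?_
  rw [← SetLike.coe_subset_coe, TopologicalSpace.Clopens.coe_finset_sup]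
  simpa using ht

/-- The clopen algebra is saturated: the nonempty open sets that the required element has to meet,
or whose complement it has to meet, are split by disjoint unions of clopen sets, which are then
separated together with the prescribed lower and upper bounds. -/
theorem isSaturated_clopens (hX : IsSaturatedSpace κ X) (hκ : ℵ₀ ≤ κ) :
    IsSaturated κ (TopologicalSpace.Clopens X) := by
  have := hX.compact
  have := hX.hausdorff
  have := hX.totallyDisconnected
  intro L M G H hL hM hG hH hLM hGM hHL
  choose c hc hcne hcG using fun g : G => hX.exists_clopen_subset_diff hκ g.1.isOpen hM
    (fun m => m.1.isClosed) (diff_iUnion_nonempty g.1 M (hGM g.1 g.2))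
  choose d hd hdne hdH using fun h : H => hX.exists_clopen_subset_diff hκ h.1.isOpen hL
    (fun l => l.1.isClosed) (diff_iUnion_nonempty h.1 L (hHL h.1 h.2))
  have hsum : ∀ {α β : Type u}, #α < κ → #β < κ → #(α ⊕ β) < κ := fun hα hβ => by
    rw [mk_sum, Cardinal.lift_id, Cardinal.lift_id]
    exact add_lt_of_lt hκ hα hβ
  obtain ⟨s, t, hs, ht, hst⟩ := hX.exists_splitting hκ (hsum hG hH) (G := Sum.elim c d)
    (by rintro (g | h); exacts [(hc g).isOpen, (hd h).isOpen])
    (by rintro (g | h); exacts [hcne g, hdne h])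
  have hdisj := hX.disjoint_closure (L ⊕ G) (M ⊕ H) (Sum.elim (fun l => l.1) fun g => s (.inl g))
    (Sum.elim (fun m => m.1) fun h => t (.inr h)) (hsum hL hG) (hsum hM hH)
    (by rintro (l | g); exacts [l.1.isClopen, (hs _).1])
    (by rintro (m | h); exacts [m.1.isClopen, (ht _).1])
    (by
      rintro (l | g) (m | h)
      · exact TopologicalSpace.Clopens.coe_disjoint.2 (hLM _ l.2 _ m.2)
      · exact disjoint_left.2 fun x hxl hxt =>
          (hdH h ((ht _).2.2 hxt)).2 (mem_iUnion.2 ⟨l, hxl⟩)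
      · exact disjoint_left.2 fun x hxs hxm =>
          (hcG g ((hs _).2.2 hxs)).2 (mem_iUnion.2 ⟨m, hxm⟩)
      · exact hst _ _)
  obtain ⟨b, hb, hPb, hbQ⟩ := exists_clopen_of_closed_subset_open isClosed_closure
    isClosed_closure.isOpen_compl hdisj.subset_compl_right
  have hP : ∀ i, Sum.elim (fun l : L => (l.1 : Set X)) (fun g => s (.inl g)) i ⊆ b := fun i =>
    ((subset_iUnion _ i).trans subset_closure).trans hPb
  have hQ : ∀ j, Sum.elim (fun m : M => (m.1 : Set X)) (fun h => t (.inr h)) j ⊆ bᶜ := fun j =>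
    ((subset_iUnion _ j).trans subset_closure).trans (subset_compl_comm.1 hbQ)
  refine ⟨⟨b, hb⟩, fun l hl => hP (.inl ⟨l, hl⟩), fun m hm => hQ (.inl ⟨m, hm⟩),
    fun g hg hle => ?_, fun h hh hle => ?_⟩
  · obtain ⟨x, hx⟩ := (hs (.inl ⟨g, hg⟩)).2.1
    exact hle (hcG ⟨g, hg⟩ ((hs (.inl ⟨g, hg⟩)).2.2 hx)).1 (hP (.inr ⟨g, hg⟩) hx)
  · obtain ⟨x, hx⟩ := (ht (.inr ⟨h, hh⟩)).2.1
    exact hQ (.inr ⟨h, hh⟩) hx (hle (hdH ⟨h, hh⟩ ((ht (.inr ⟨h, hh⟩)).2.2 hx)).1)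

theorem nonempty_homeomorph {Y : Type u} [TopologicalSpace Y] [Nonempty X] [Nonempty Y]
    (hX : IsSaturatedSpace κ X) (hY : IsSaturatedSpace κ Y) (hκ : ℵ₀ ≤ κ) :
    Nonempty (X ≃ₜ Y) := by
  have := hX.compact
  have := hX.hausdorff
  have := hX.totallyDisconnected
  have := hY.compact
  have := hY.hausdorff
  have := hY.totallyDisconnected
  have hnt : ∀ (W : Type u) [TopologicalSpace W] [Nonempty W],
      Nontrivial (TopologicalSpace.Clopens W) := fun W _ ⟨w⟩ =>
    ⟨⊤, ⊥, fun h => by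
      have : w ∈ (⊤ : TopologicalSpace.Clopens W) := mem_univ w
      rw [h] at this
      exact this⟩
  have := hnt X
  have := hnt Y
  obtain ⟨φ⟩ := (hX.isSaturated_clopens hκ).nonempty_orderIso hκ (hY.isSaturated_clopens hκ)
    hX.mk_clopens_le hY.mk_clopens_le
  exact nonempty_homeomorph_of_clopens_orderIso φ

end IsSaturatedSpace

/-! ### Parovičenko spaces are saturated -/

section Parovicenko

variable {κ : Cardinal.{u}} {X : Type u} [TopologicalSpace X]

/-- Disjoint unions of fewer than `κ` clopen sets in an `F_κ`-space have disjoint closures: extend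
the function that is `1` on one of them and `0` on the other. -/
lemma IsFSpace.disjoint_closure (hX : IsFSpace κ X) (hκ : ℵ₀ ≤ κ) {ι ι' : Type u} {c : ι → Set X}
    {d : ι' → Set X} (hι : #ι < κ) (hι' : #ι' < κ) (hc : ∀ i, IsClopen (c i))
    (hd : ∀ j, IsClopen (d j)) (hcd : ∀ i j, Disjoint (c i) (d j)) :
    Disjoint (closure (⋃ i, c i)) (closure (⋃ j, d j)) := by
  classical
  set U := ⋃ i, c i
  set V := ⋃ j, d j
  have hUo : IsOpen U := isOpen_iUnion fun i => (hc i).isOpen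
  have hVo : IsOpen V := isOpen_iUnion fun j => (hd j).isOpen
  have hUV : Disjoint U V := by
    simpa only [U, V, disjoint_iUnion_left, disjoint_iUnion_right] using fun i j => hcd j i
  have htype : openType (U ∪ V) < κ := by
    refine (csInf_le' ⟨range c ∪ range d, ?_, ?_, rfl⟩ : openType (U ∪ V) ≤ _).trans_lt
      ((mk_union_le _ _).trans_lt
        (add_lt_of_lt hκ (mk_range_le.trans_lt hι) (mk_range_le.trans_lt hι')))
    · rintro _ (⟨i, rfl⟩ | ⟨j, rfl⟩)
      exacts [hc i, hd j]
    · rw [sUnion_union, sUnion_range, sUnion_range]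
  have hclopen : IsClopen {a : ↥(U ∪ V) | a.1 ∈ U} := by
    refine ⟨⟨?_⟩, hUo.preimage continuous_subtype_val⟩
    convert hVo.preimage (continuous_subtype_val (p := (· ∈ U ∪ V))) using 1
    ext a
    exact ⟨fun ha => a.2.resolve_left ha, fun ha hau => disjoint_left.1 hUV hau ha⟩
  let f : ↥(U ∪ V) →ᵇ ℝ := BoundedContinuousFunction.ofNormedAddCommGroup
    (indicator {a : ↥(U ∪ V) | a.1 ∈ U} 1)
    (continuous_one.indicator (by simp [hclopen.frontier_eq])) 1 fun a => by
      by_cases ha : a.1 ∈ U <;> simp [indicator, ha]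
  obtain ⟨g, hg⟩ := hX.cstar _ (hUo.union hVo) htype f
  have hgU : closure U ⊆ g ⁻¹' {1} :=
    closure_minimal (fun x hx => by
      have := hg ⟨x, .inl hx⟩
      simpa [f, indicator, hx] using this) (isClosed_singleton.preimage g.continuous)
  have hgV : closure V ⊆ g ⁻¹' {0} :=
    closure_minimal (fun x hx => by
      have := hg ⟨x, .inr hx⟩
      simpa [f, indicator, disjoint_right.1 hUV hx] using this)
      (isClosed_singleton.preimage g.continuous)
  exact Disjoint.mono hgU hgV (Disjoint.preimage _ (by simp))

lemma mk_clopens_le_weight [CompactSpace X] (hκ : ℵ₀ ≤ κ) (hw : weight X ≤ κ) :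
    #(TopologicalSpace.Clopens X) ≤ κ := by
  obtain ⟨B, hB, hBw⟩ := csInf_mem (s := {c | ∃ B : Set (Set X),
    TopologicalSpace.IsTopologicalBasis B ∧ #B = c})
    ⟨_, _, TopologicalSpace.isTopologicalBasis_opens, rfl⟩
  have hBκ : #B ≤ κ := hBw.le.trans hw
  have hex : ∀ c : TopologicalSpace.Clopens X, ∃ t : Finset B, (c : Set X) = ⋃ b ∈ t, b.1 := by
    intro c
    obtain ⟨s, hs, hcs⟩ := eq_finite_iUnion_of_isTopologicalBasis_of_isCompact_open
      (Subtype.val : B → Set X) (by rwa [Subtype.range_coe]) c c.isClosed.isCompact c.isOpen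
    exact ⟨hs.toFinset, by simpa using hcs⟩
  choose t ht using hex
  have hinj : Function.Injective t := fun c c' h =>
    SetLike.coe_injective (by rw [ht, ht, h])
  refine (mk_le_of_injective hinj).trans ?_
  cases finite_or_infinite B
  · exact (lt_aleph0_of_finite _).le.trans hκ
  · rwa [mk_finset_of_infinite]

lemma IsParovicenko.isSaturatedSpace (hX : IsParovicenko κ X) (hκ : ℵ₀ ≤ κ) (hpow : κ = κ ^< κ) :
    IsSaturatedSpace κ X where
  compact := hX.compact
  hausdorff := hX.hausdorff
  totallyDisconnected := by
    have := hX.hausdorff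
    have := totallySeparatedSpace_of_t0_of_basis_clopen hX.fSpace.zeroDim
    infer_instance
  mk_clopens_le := by
    have := hX.compact
    exact mk_clopens_le_weight hκ (hX.weight_eq.trans hpow.symm).le
  no_isolated := hX.no_isolated
  interior_nonempty := hX.interior_nonempty
  disjoint_closure _ _ _ _ hι hι' hc hd hcd := hX.fSpace.disjoint_closure hκ hι hι' hc hd hcd

end Parovicenko

/-! ### Collapsing the remainder of a finite compactification -/

/-- The map `r : Z → S` collapses a finite nowhere dense subset of `Z` to the point `x` and is a
homeomorphism from its complement onto `S \ {x}`. -/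
structure IsCollapse {Z : Type v} {S : Type u} [TopologicalSpace Z] [TopologicalSpace S]
    (r : Z → S) (x : S) : Prop where
  continuous : Continuous r
  inj : ∀ p q, r p = r q → r p ≠ x → p = q
  surj : ∀ s, s ≠ x → ∃ p, r p = s
  isOpen_image : ∀ W : Set Z, IsOpen W → (∀ p ∈ W, r p ≠ x) → IsOpen (r '' W)
  finite : {p | r p = x}.Finite
  dense : ∀ W : Set Z, IsOpen W → W.Nonempty → ∃ p ∈ W, r p ≠ x

/-- Sending the remainder of a finite compactification of `S \ {x}` to `x` is continuous, because
`S` is the one-point compactification of `S \ {x}`. -/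
lemma IsFiniteCompactification.exists_isCollapse {S : Type u} [TopologicalSpace S] [CompactSpace S]
    [T2Space S] {x : S} {Z : Type v} [TopologicalSpace Z] {e : {y : S // y ≠ x} → Z}
    (he : IsFiniteCompactification e) :
    ∃ r : Z → S, IsCollapse r x ∧ ∀ z, r z = x ↔ z ∉ range e := by
  classical
  have := he.hausdorff
  have hinj := he.embedding.injective
  have hopen : IsOpen (range e) := by
    rw [← isClosed_compl_iff]
    exact he.finite_remainder.isClosed
  have hoe : IsOpenEmbedding e := ⟨he.embedding, hopen⟩
  have hoi : IsOpenEmbedding (Subtype.val : {y : S // y ≠ x} → S) :=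
    isOpen_compl_singleton.isOpenEmbedding_subtypeVal
  let r : Z → S := fun z => if h : z ∈ range e then h.choose.1 else x
  have hre : ∀ y, r (e y) = y.1 := fun y => by
    have h : e y ∈ range e := ⟨y, rfl⟩
    simp only [r, dif_pos h]
    rw [hinj h.choose_spec]
  have hrx : ∀ z, r z = x ↔ z ∉ range e := fun z => by
    refine ⟨?_, fun h => dif_neg h⟩
    rintro hz ⟨y, rfl⟩
    exact y.2 ((hre y).symm.trans hz)
  have hpre : ∀ T : Set S, x ∉ T → r ⁻¹' T = e '' (Subtype.val ⁻¹' T) := by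
    intro T hT
    ext z
    constructor
    · intro hz
      obtain ⟨y, rfl⟩ : z ∈ range e := by
        by_contra h
        exact hT ((hrx z).2 h ▸ hz)
      exact ⟨y, by simpa only [mem_preimage, hre] using hz, rfl⟩
    · rintro ⟨y, hy, rfl⟩
      simpa only [mem_preimage, hre] using hy
  refine ⟨r, ⟨?_, ?_, fun s hs => ⟨e ⟨s, hs⟩, hre _⟩, ?_, ?_, ?_⟩, hrx⟩
  · refine continuous_iff_isClosed.2 fun T hT => ?_
    by_cases hxT : x ∈ T
    · rw [← isOpen_compl_iff, ← preimage_compl, hpre _ (by simpa using hxT)]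
      exact hoe.isOpenMap _ (hT.isOpen_compl.preimage continuous_subtype_val)
    · rw [hpre _ hxT]
      refine (IsCompact.image ?_ hoe.continuous).isClosed
      refine hoi.isInducing.isCompact_preimage' hT.isCompact fun s hs => ?_
      exact ⟨⟨s, ne_of_mem_of_not_mem hs hxT⟩, rfl⟩
  · intro p q hpq hp
    obtain ⟨y, rfl⟩ : p ∈ range e := by_contra fun h => hp ((hrx p).2 h)
    obtain ⟨y', rfl⟩ : q ∈ range e := by_contra fun h => (hpq ▸ hp) ((hrx q).2 h)
    rw [hre, hre] at hpq
    rw [Subtype.ext hpq]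
  · intro W hW hWx
    have : r '' W = Subtype.val '' (e ⁻¹' W) := by
      ext s
      constructor
      · rintro ⟨z, hz, rfl⟩
        obtain ⟨y, rfl⟩ : z ∈ range e := by_contra fun h => hWx z hz ((hrx z).2 h)
        exact ⟨y, hz, (hre y).symm⟩
      · rintro ⟨y, hy, rfl⟩
        exact ⟨e y, hy, hre y⟩
    rw [this]
    exact hoi.isOpenMap _ (hW.preimage hoe.continuous)
  · simp only [hrx]
    exact he.finite_remainder
  · intro W hW hne
    obtain ⟨y, hy⟩ := he.dense.exists_mem_open hW hne
    exact ⟨e y, hy, by rw [hre]; exact y.2⟩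

namespace IsCollapse

variable {κ : Cardinal.{u}} {S : Type u} [TopologicalSpace S] {x : S}

section

variable {Z : Type v} [TopologicalSpace Z] {r : Z → S}

lemma comp_homeomorph {Z' : Type*} [TopologicalSpace Z'] (hr : IsCollapse r x) (h : Z' ≃ₜ Z) :
    IsCollapse (r ∘ h) x where
  continuous := hr.continuous.comp h.continuous
  inj p q hpq hp := h.injective (hr.inj _ _ hpq hp)
  surj s hs := by
    obtain ⟨p, hp⟩ := hr.surj s hs
    exact ⟨h.symm p, by simpa using hp⟩
  isOpen_image W hW hWx := by
    rw [image_comp]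
    refine hr.isOpen_image _ (h.isOpenMap _ hW) ?_
    rintro _ ⟨p, hp, rfl⟩
    exact hWx p hp
  finite := hr.finite.preimage h.injective.injOn
  dense W hW hne := by
    obtain ⟨_, ⟨p, hp, rfl⟩, hpx⟩ := hr.dense _ (h.isOpenMap _ hW) (hne.image h)
    exact ⟨p, hp, hpx⟩

/-- A preconnected set meets only one fibre of `r`, and all fibres of `r` are finite. -/
lemma totallyDisconnectedSpace [T1Space Z] [TotallyDisconnectedSpace S] (hr : IsCollapse r x) :
    TotallyDisconnectedSpace Z := by
  refine ⟨fun t _ ht => ?_⟩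
  by_contra hns
  have hnt := not_subsingleton_iff.1 hns
  have himg := (ht.image r hr.continuous.continuousOn).subsingleton
  obtain ⟨p, hp⟩ := hnt.nonempty
  by_cases hpx : r p = x
  · exact ht.infinite_of_nontrivial hnt
      (hr.finite.subset fun q hq => (himg (mem_image_of_mem r hq) (mem_image_of_mem r hp)).trans hpx)
  · have : ∀ q ∈ t, p = q := fun q hq =>
      hr.inj p q (himg (mem_image_of_mem r hp) (mem_image_of_mem r hq)) hpx
    exact hns fun q hq q' hq' => (this q hq).symm.trans (this q' hq')

lemma isClopen_image [CompactSpace Z] [T2Space S] (hr : IsCollapse r x) {W : Set Z}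
    (hW : IsClopen W) (hWx : ∀ p ∈ W, r p ≠ x) : IsClopen (r '' W) :=
  ⟨(hW.isClosed.isCompact.image hr.continuous).isClosed, hr.isOpen_image W hW.isOpen hWx⟩

lemma exists_isolating_clopen [CompactSpace Z] [T2Space Z] [TotallyDisconnectedSpace Z]
    (hr : IsCollapse r x) {p : Z} {U : Set Z} (hU : U ∈ 𝓝 p) :
    ∃ N, IsClopen N ∧ p ∈ N ∧ N ⊆ U ∧ ∀ q ∈ N, r q = x → q = p := by
  have hO : IsOpen (interior U ∩ ({q | r q = x} \ {p})ᶜ) :=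
    isOpen_interior.inter (hr.finite.subset sdiff_subset).isClosed.isOpen_compl
  obtain ⟨N, hN, hpN, hNO⟩ := compact_exists_isClopen_in_isOpen hO
    (mem_inter (mem_interior_iff_mem_nhds.2 hU) fun h => h.2 rfl)
  refine ⟨N, hN, hpN, fun q hq => interior_subset (hNO hq).1, fun q hq hqx => ?_⟩
  by_contra hqp
  exact (hNO hq).2 ⟨hqx, hqp⟩

/-- Disjoint unions of fewer than `κ` clopen sets of `Z` that avoid the collapsed set have images
with disjoint closures in `S`. -/
lemma map_ne_of_mem_closure [CompactSpace Z] (hr : IsCollapse r x) (hS : IsSaturatedSpace κ S)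
    {ι ι' : Type u} {c : ι → Set Z} {d : ι' → Set Z} (hι : #ι < κ) (hι' : #ι' < κ)
    (hc : ∀ i, IsClopen (c i)) (hd : ∀ j, IsClopen (d j)) (hcx : ∀ i, ∀ p ∈ c i, r p ≠ x)
    (hdx : ∀ j, ∀ p ∈ d j, r p ≠ x) (hcd : ∀ i j, Disjoint (c i) (d j)) {p q : Z}
    (hp : p ∈ closure (⋃ i, c i)) (hq : q ∈ closure (⋃ j, d j)) : r p ≠ r q := by
  have := hS.hausdorff
  intro hpq
  have hdisj := hS.disjoint_closure ι ι' (fun i => r '' c i) (fun j => r '' d j) hι hι'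
    (fun i => hr.isClopen_image (hc i) (hcx i)) (fun j => hr.isClopen_image (hd j) (hdx j))
    (fun i j => by
      rw [disjoint_left]
      rintro _ ⟨a, ha, rfl⟩ ⟨b, hb, hab⟩
      exact disjoint_left.1 (hcd i j) ha (hr.inj b a hab (hdx j b hb) ▸ hb))
  rw [← image_iUnion, ← image_iUnion] at hdisj
  refine disjoint_left.1 hdisj
    (image_closure_subset_closure_image hr.continuous (mem_image_of_mem r hp)) ?_
  rw [hpq]
  exact image_closure_subset_closure_image hr.continuous (mem_image_of_mem r hq)

/-- If a point of the collapsed set is not a `P_κ`-point, then it is in the closure of a union of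
fewer than `κ` clopen sets avoiding the collapsed set. -/
lemma exists_mem_closure_of_not_isPPoint [CompactSpace Z] [T2Space Z] [TotallyDisconnectedSpace Z]
    (hr : IsCollapse r x) {z : Z} (hz : ¬ IsPPoint κ z) {N : Set Z} (hN : IsClopen N)
    (hzN : z ∈ N) (hNx : ∀ q ∈ N, r q = x → q = z) :
    ∃ (ι : Type u) (c : ι → Set Z), #ι < κ ∧ (∀ i, IsClopen (c i)) ∧
      (∀ i, ∀ p ∈ c i, r p ≠ x) ∧ (∀ i, c i ⊆ N) ∧ z ∈ closure (⋃ i, c i) := by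
  simp only [IsPPoint, not_forall] at hz
  obtain ⟨ι, U, hι, hU, hno⟩ := hz
  choose V hV hzV hVU _ using fun i => hr.exists_isolating_clopen (hU i)
  refine ⟨ι, fun i => N \ V i, hι, fun i => hN.diff (hV i), fun i p hp hpx => ?_,
    fun i => sdiff_subset, ?_⟩
  · exact hp.2 (hNx p hp.1 hpx ▸ hzV i)
  · by_contra hcl
    refine hno ⟨N ∩ (closure (⋃ i, N \ V i))ᶜ, hN.isOpen.inter isClosed_closure.isOpen_compl,
      ⟨hzN, hcl⟩, fun q hq => mem_iInter.2 fun i => hVU i ?_⟩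
    by_contra hqV
    exact hq.2 (subset_closure (mem_iUnion.2 ⟨i, hq.1, hqV⟩))

lemma subsingleton_not_isPPoint [CompactSpace Z] [T2Space Z] [TotallyDisconnectedSpace Z]
    (hr : IsCollapse r x) (hS : IsSaturatedSpace κ S) :
    {z | r z = x ∧ ¬ IsPPoint κ z}.Subsingleton := by
  rintro z ⟨hzx, hz⟩ w ⟨hwx, hw⟩
  by_contra hzw
  obtain ⟨N, hN, hzN, -, hNx⟩ := hr.exists_isolating_clopen (p := z) Filter.univ_mem
  have hwN : w ∉ N := fun h => hzw (hNx w h hwx).symm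
  obtain ⟨N', hN', hwN', hN'N, hN'x⟩ := hr.exists_isolating_clopen
    (hN.isClosed.isOpen_compl.mem_nhds hwN)
  obtain ⟨ι, c, hι, hc, hcx, hcN, hzc⟩ := hr.exists_mem_closure_of_not_isPPoint hz hN hzN hNx
  obtain ⟨ι', d, hι', hd, hdx, hdN, hwd⟩ :=
    hr.exists_mem_closure_of_not_isPPoint hw hN' hwN' hN'x
  exact hr.map_ne_of_mem_closure hS hι hι' hc hd hcx hdx
    (fun i j => disjoint_left.2 fun p hp hp' => hN'N (hdN j hp') (hcN i hp)) hzc hwd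
    (hzx.trans hwx.symm)

end

/-! ### Finite compactifications are saturated -/

variable {Z : Type u} [TopologicalSpace Z] {r : Z → S}

/-- A clopen set is determined by its trace `T` on the collapsed set together with its symmetric
difference from a fixed clopen set with trace `T`, which corresponds to a clopen set of `S`. -/
lemma mk_clopens_le [CompactSpace Z] (hr : IsCollapse r x) (hS : IsSaturatedSpace κ S)
    (hκ : ℵ₀ ≤ κ) : #(TopologicalSpace.Clopens Z) ≤ κ := by
  classical
  have := hS.hausdorff
  set F : Set Z := {p | r p = x}
  have hF : Finite F := hr.finite
  let trace : TopologicalSpace.Clopens Z → Set F := fun N => {p | p.1 ∈ N}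
  let rep : Set F → TopologicalSpace.Clopens Z := Function.invFun trace
  have hrep : ∀ N, trace (rep (trace N)) = trace N := fun N => Function.invFun_eq ⟨N, rfl⟩
  have havoid : ∀ N : TopologicalSpace.Clopens Z,
      ∀ p ∈ symmDiff (N : Set Z) (rep (trace N)), r p ≠ x := by
    intro N p hp hpx
    have h := Set.ext_iff.1 (hrep N) ⟨p, hpx⟩
    change p ∈ rep (trace N) ↔ p ∈ N at h
    rcases hp with hp | hp
    · exact hp.2 (h.2 hp.1)
    · exact hp.2 (h.1 hp.1)
  let code : TopologicalSpace.Clopens Z → Set F × TopologicalSpace.Clopens S := fun N =>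
    (trace N, ⟨r '' symmDiff (N : Set Z) (rep (trace N)), hr.isClopen_image
      ((N.isClopen.diff (rep _).isClopen).union ((rep _).isClopen.diff N.isClopen)) (havoid N)⟩)
  have hinj : Function.Injective code := by
    intro N N' h
    obtain ⟨h1, h2⟩ := Prod.ext_iff.1 h
    replace h1 : trace N = trace N' := h1
    replace h2 : r '' symmDiff (N : Set Z) (rep (trace N)) =
      r '' symmDiff (N' : Set Z) (rep (trace N')) := congrArg SetLike.coe h2
    have hsub : ∀ M M' : TopologicalSpace.Clopens Z,
        r '' symmDiff (M : Set Z) (rep (trace M)) =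
          r '' symmDiff (M' : Set Z) (rep (trace M')) →
        symmDiff (M : Set Z) (rep (trace M)) ⊆ symmDiff (M' : Set Z) (rep (trace M')) := by
      intro M M' h p hp
      obtain ⟨q, hq, hqp⟩ := h ▸ mem_image_of_mem r hp
      exact hr.inj q p hqp (havoid M' q hq) ▸ hq
    have h3 := (hsub N N' h2).antisymm (hsub N' N h2.symm)
    rw [h1] at h3
    exact SetLike.coe_injective (symmDiff_left_injective _ h3)
  refine (mk_le_of_injective hinj).trans ?_
  rw [mk_prod, Cardinal.lift_id, Cardinal.lift_id]
  exact mul_le_of_le hκ ((lt_aleph0_of_finite _).le.trans hκ) hS.mk_clopens_le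

/-- If an intersection of fewer than `κ` open sets were contained in the collapsed set, then
splitting the traces on `S \ {x}` of the finite subintersections would give two disjoint unions of
fewer than `κ` clopen sets of `S` with `x` in both closures. -/
lemma exists_mem_iInter_ne [CompactSpace Z] [T2Space Z] [TotallyDisconnectedSpace Z]
    (hr : IsCollapse r x) (hS : IsSaturatedSpace κ S) (hκ : ℵ₀ ≤ κ) {ι : Type u} {U : ι → Set Z}
    (hι : #ι < κ) (hU : ∀ i, IsOpen (U i)) (hne : (⋂ i, U i).Nonempty) :
    ∃ p ∈ ⋂ i, U i, r p ≠ x := by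
  by_contra! hall
  have := hS.hausdorff
  obtain ⟨p, hp⟩ := hne
  have hpx := hall p hp
  obtain ⟨N, hN, hpN, -, hNx⟩ := hr.exists_isolating_clopen (p := p) Filter.univ_mem
  choose V hV hpV hVU _ using fun i =>
    hr.exists_isolating_clopen ((hU i).mem_nhds (mem_iInter.1 hp i))
  let W : Finset ι → Set Z := fun t => N ∩ ⋂ i ∈ t, V i
  have hWo : ∀ t, IsOpen (W t) := fun t =>
    hN.isOpen.inter (isOpen_biInter_finset fun i _ => (hV i).isOpen)
  have hpW : ∀ t, p ∈ W t := fun t => ⟨hpN, mem_iInter₂.2 fun i _ => hpV i⟩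
  obtain ⟨c, d, hc, hd, hcd⟩ := hS.exists_splitting hκ (mk_finset_lt hκ hι)
    (G := fun t => r '' (W t ∩ {q | r q ≠ x}))
    (fun t => hr.isOpen_image _ ((hWo t).inter
      (isOpen_compl_singleton.preimage hr.continuous)) fun q hq => hq.2)
    (fun t => by
      obtain ⟨q, hq, hqx⟩ := hr.dense _ (hWo t) ⟨p, hpW t⟩
      exact ⟨r q, q, ⟨hq, hqx⟩, rfl⟩)
  have hcl : ∀ c : Finset ι → Set S, (∀ t, IsClopen (c t) ∧ (c t).Nonempty ∧
      c t ⊆ r '' (W t ∩ {q | r q ≠ x})) → x ∈ closure (⋃ t, c t) := by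
    intro c hc
    have hclosed : IsClosed (closure (r ⁻¹' ⋃ t, c t) ∩ N) := isClosed_closure.inter hN.isClosed
    obtain ⟨w, ⟨hw, hwN⟩, hwV⟩ := hclosed.isCompact.inter_iInter_nonempty V
      (fun i => (hV i).isClosed) fun t => by
        obtain ⟨s, hs⟩ := (hc t).2.1
        obtain ⟨q, hq, rfl⟩ := (hc t).2.2 hs
        exact ⟨q, ⟨subset_closure (mem_iUnion.2 ⟨t, hs⟩), hq.1.1⟩, hq.1.2⟩
    have hwx : r w = x := hall w (iInter_mono hVU hwV)
    rw [← hwx]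
    exact closure_mono (image_preimage_subset _ _)
      (image_closure_subset_closure_image hr.continuous (mem_image_of_mem r hw))
  exact disjoint_left.1 (hS.disjoint_closure _ _ c d (mk_finset_lt hκ hι) (mk_finset_lt hκ hι)
    (fun t => (hc t).1) (fun t => (hd t).1) hcd) (hcl c hc) (hcl d hd)

theorem isSaturatedSpace [CompactSpace Z] [T2Space Z] (hr : IsCollapse r x)
    (hS : IsSaturatedSpace κ S) (hκ : ℵ₀ ≤ κ) : IsSaturatedSpace κ Z := by
  have := hS.hausdorff
  have := hS.totallyDisconnected
  have htd : TotallyDisconnectedSpace Z := hr.totallyDisconnectedSpace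
  refine ⟨‹_›, ‹_›, htd, hr.mk_clopens_le hS hκ, fun z hz => ?_, fun ι U hι hU hne => ?_, ?_⟩
  · obtain ⟨p, rfl, hp⟩ := hr.dense {z} hz (singleton_nonempty z)
    refine hS.no_isolated (r p) ?_
    rw [← image_singleton]
    exact hr.isOpen_image _ hz fun q hq => hq ▸ hp
  · obtain ⟨p, hp, hpx⟩ := hr.exists_mem_iInter_ne hS hκ hι hU hne
    obtain ⟨s, hs⟩ := hS.interior_nonempty ι (fun i => r '' (U i ∩ {q | r q ≠ x})) hι
      (fun i => hr.isOpen_image _ ((hU i).inter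
        (isOpen_compl_singleton.preimage hr.continuous)) fun q hq => hq.2)
      ⟨r p, mem_iInter.2 fun i => ⟨p, ⟨mem_iInter.1 hp i, hpx⟩, rfl⟩⟩
    set O := interior (⋂ i, r '' (U i ∩ {q | r q ≠ x}))
    obtain ⟨s', hs', hs'x⟩ : ∃ s' ∈ O, s' ≠ x := by
      by_contra! h
      refine hS.no_isolated x ?_
      rw [← (Nonempty.subset_singleton_iff ⟨s, hs⟩).1 h]
      exact isOpen_interior
    obtain ⟨q, rfl⟩ := hr.surj s' hs'x
    refine ⟨q, mem_interior.2 ⟨r ⁻¹' (O ∩ {x}ᶜ), fun q' hq' => mem_iInter.2 fun i => ?_,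
      (isOpen_interior.inter isOpen_compl_singleton).preimage hr.continuous, hs', hs'x⟩⟩
    obtain ⟨w, hw, hwq⟩ := mem_iInter.1 (interior_subset hq'.1) i
    exact hr.inj w q' hwq hw.2 ▸ hw.1
  · intro ι ι' c d hι hι' hc hd hcd
    refine disjoint_left.2 fun p hpc hpd => ?_
    have hUV : Disjoint (⋃ i, c i) (⋃ j, d j) := by
      simpa only [disjoint_iUnion_left, disjoint_iUnion_right] using fun i j => hcd j i
    have hpc' : p ∉ ⋃ i, c i := fun h =>
      disjoint_left.1 (hUV.closure_right (isOpen_iUnion fun i => (hc i).isOpen)) h hpd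
    have hpd' : p ∉ ⋃ j, d j := fun h =>
      disjoint_left.1 (hUV.closure_left (isOpen_iUnion fun j => (hd j).isOpen)) hpc h
    obtain ⟨N, hN, hpN, -, hNx⟩ := hr.exists_isolating_clopen (p := p) Filter.univ_mem
    have hN' : ∀ {A : Set Z}, p ∈ closure A → p ∈ closure (N ∩ A) := fun h =>
      hN.isOpen.inter_closure ⟨hpN, h⟩
    refine hr.map_ne_of_mem_closure hS hι hι' (fun i => hN.inter (hc i))
      (fun j => hN.inter (hd j)) (fun i q hq hqx => ?_) (fun j q hq hqx => ?_)
      (fun i j => (hcd i j).mono inter_subset_right inter_subset_right)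
      (p := p) (q := p) ?_ ?_ rfl
    · exact hpc' (mem_iUnion.2 ⟨i, hNx q hq.1 hqx ▸ hq.2⟩)
    · exact hpd' (mem_iUnion.2 ⟨j, hNx q hq.1 hqx ▸ hq.2⟩)
    · rw [← inter_iUnion]
      exact hN' hpc
    · rw [← inter_iUnion]
      exact hN' hpd

end IsCollapse

lemma IsFiniteCompactification.small {Y : Type u} {Z : Type v} [TopologicalSpace Y]
    [TopologicalSpace Z] {e : Y → Z} (he : IsFiniteCompactification e) : Small.{u} Z := by
  have : Finite ↥(range e)ᶜ := he.finite_remainder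
  rw [← small_univ_iff, ← union_compl_self (range e)]
  exact small_union _ _

end KappaParovicenko

theorem theorem4p3 (κ : Cardinal.{u}) (hκ : ℵ₀ ≤ κ) (hpow : κ = κ ^< κ)
    (S : Type u) [TopologicalSpace S] (hS : KappaParovicenko.IsParovicenko κ S) (x : S)
    (Z : Type v) [TopologicalSpace Z] (e : {y : S // y ≠ x} → Z)
    (he : KappaParovicenko.IsFiniteCompactification e) :
    Nonempty (Z ≃ₜ S) ∧
      {z : Z | z ∉ range e ∧ ¬ KappaParovicenko.IsPPoint κ z}.Subsingleton := by
  have := hS.compact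
  have := hS.hausdorff
  have := he.compact
  have := he.hausdorff
  have := he.small
  have hSsat := hS.isSaturatedSpace hκ hpow
  have := hSsat.totallyDisconnected
  obtain ⟨r, hr, hrx⟩ := he.exists_isCollapse
  have : TotallyDisconnectedSpace Z := hr.totallyDisconnectedSpace
  refine ⟨?_, ?_⟩
  · let h := Shrink.homeomorph.{u} Z
    have := h.compactSpace
    have := h.t2Space
    have hZsat := (hr.comp_homeomorph h.symm).isSaturatedSpace hSsat hκ
    obtain ⟨s, hs⟩ : ∃ s, s ≠ x := by
      by_contra! hall
      have huniv : ({x} : Set S) = Set.univ := eq_univ_of_forall hall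
      exact hS.no_isolated x (huniv ▸ isOpen_univ)
    have : Nonempty S := ⟨x⟩
    have : Nonempty (Shrink.{u} Z) := ⟨h (e ⟨s, hs⟩)⟩
    obtain ⟨g⟩ := hZsat.nonempty_homeomorph hSsat hκ
    exact ⟨h.trans g⟩
  · simpa only [hrx] using hr.subsingleton_not_isPPoint hSsat
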